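/- Let $\mathsf M$ be a countable set of unary diamonds. An $\mathsf M$-BAO is a boolean algebra $\mathcal B$ with an operator for each $\lozenge\in\mathsf M$ satisfying $\lozenge 0=0$ and $\lozenge(a+b)=\lozenge a+\lozenge b$. Its canonical frame $\mathcal B_+$ is the set of ultrafilters of $\mathcal B$ with the relations $R_\lozenge\mu\nu\iff\forall a\,(a\in\nu\Rightarrow\lozenge a\in\mu)$, and its canonical extension $\mathcal B^\sigma$ is the algebra $\wp(\mathcal B_+)$ with $\lozenge X=\{\mu:\exists\nu\in X\ R_\lozenge\mu\nu\}$. A variety $V$ of $\mathsf M$-BAOs (a class defined by equations) is *canonical* if $\mathcal B^\sigma\in V$ for every $\mathcal B\in V$, *$\kappa$-canonical* if this holds for every $\mathcal B\in V$ generated by at most $\kappa$ elements, and *resolved* if it is canonical or not $(|\mathsf M|+\omega)$-canonical. Fix a variety $V$. For $\mathcal B\in V$ and a valuation $g:\{q_i:i<\omega\}\to\wp(\mathcal B_+)$, let $\mathfrak B=(\mathcal B,\mathcal B_+)$ be the two-sorted structure with the operations of $\mathcal B$, the membership relation between $\mathcal B$ and $\mathcal B_+$, the relations $R_\lozenge$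 on $\mathcal B_+$, and unary relations $Q_i=g(q_i)$ on $\mathcal B_+$. Let $\mathfrak A=(\mathcal A,W)\preceq\mathfrak B$ be a countable elementary substructure; for $w\in W$ put $\hat w=\{a\in\mathcal A:a\in w\}$, an ultrafilter of $\mathcal A$. Let $\mathcal L(\mathfrak A)$ be the signature of $\mathfrak B$ with a constant added for each element of $\mathfrak A$. **(1)** There are an ultrapower $\mathfrak A^*$ of $\mathfrak A$ and an $\mathcal L(\mathfrak A)$-elementary embedding $\sigma:\mathfrak B\to\mathfrak A^*$. For every such $\mathfrak A^*$ and $\sigma$, define $f:\mathcal A_+\to\mathcal B_+$ by $f(\mu)=\{b\in\mathcal B:\sigma(b)\in\mu^*\}$, where $\mu^*$ is the interpretation in the ultrapower $(\mathfrak A,\mu)^*$ of a unary predicate naming the ultrafilter $\mu$ of $\mathcal A$. Then $f$ is well defined, is an embedding of frames (injective, preserving and reflecting each $R_\lozenge$), and $f(\hat w)=w$ for every $w\in W$. **(2)** Say that *the Truth Lemma holds in $V$* if the following always holds: for all $\mathcal B\in V$ and $g,\mathfrak A,\mathfrak A^*,\sigma,f$ as above, every modal $\mathsf M$-formula $\phi_0$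 and every $w_0\in W$ with $(\mathcal B_+,g),w_0\models\phi_0$, if $\mathcal F$ is the inner subframe of $\mathcal A_+$ generated by $\hat w_0$ and $\mathcal M$ is the submodel of $(\mathcal B_+,g)$ with domain $f(\mathcal F)$, then for each $m\in\mathcal M$ and each modal $\mathsf M$-formula $\psi$, $$\mathcal M,m\models\psi\iff(\mathcal B_+,g),m\models\psi .$$ If the Truth Lemma holds in $V$, then $V$ is resolved. -/

import Mathlib

open Cardinal FirstOrder

universe u

namespace ModalBAO

/-! ### Modal formulas, Kripke frames and models -/

/-- Modal formulas over the set `M` of diamonds, with atoms `q_i` indexed by `ℕ`. -/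
inductive Formula (M : Type u) : Type u
  | top : Formula M
  | atom : ℕ → Formula M
  | neg : Formula M → Formula M
  | or : Formula M → Formula M → Formula M
  | dia : M → Formula M → Formula M

/-- A Kripke frame: a set with a binary relation for each diamond. -/
structure Frame (M : Type u) : Type (u + 1) where
  carrier : Type u
  R : M → carrier → carrier → Prop

/-- The subframe of `F` with domain `D`. -/
def Frame.sub {M : Type u} (F : Frame M) (D : Set F.carrier) : Frame M where
  carrier := D
  R d x y := F.R d x y

/-- The composed relation `R_s` of a finite sequence `s` of diamonds. The head of the list is the
last diamond of the sequence: `R_∅ x y` is `x = y`, and appending `d` to `s` gives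
`∃ z, R_s x z ∧ R_d z y`. -/
def Frame.path {M : Type u} (F : Frame M) : List M → F.carrier → F.carrier → Prop
  | [], x, y => x = y
  | d :: s, x, y => ∃ z, F.path s x z ∧ F.R d z y

/-- The domain of the inner subframe of `F` generated by the point `w`. -/
def Frame.generated {M : Type u} (F : Frame M) (w : F.carrier) : Set F.carrier :=
  {x | ∃ s : List M, F.path s w x}

/-- Embeddings of frames: injective maps preserving and reflecting every relation. -/
def Frame.IsEmbedding {M : Type u} {F G : Frame M} (f : F.carrier → G.carrier) : Prop :=
  Function.Injective f ∧ ∀ (d : M) (x y : F.carrier), F.R d x y ↔ G.R d (f x) (f y)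

/-- A Kripke model: a frame with a valuation of the atoms. -/
structure Model (M : Type u) : Type (u + 1) extends Frame M where
  val : ℕ → Set carrier

/-- The submodel of `N` with domain `D`. -/
def Model.sub {M : Type u} (N : Model M) (D : Set N.carrier) : Model M where
  toFrame := N.toFrame.sub D
  val i := {x | x.1 ∈ N.val i}

/-- `N.Sat w φ`: the formula `φ` is true in the model `N` at the point `w`. -/
def Model.Sat {M : Type u} (N : Model M) : N.carrier → Formula M → Prop
  | _, .top => True
  | w, .atom i => w ∈ N.val i
  | w, .neg φ => ¬ N.Sat w φ
  | w, .or φ ψ => N.Sat w φ ∨ N.Sat w ψ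
  | w, .dia d φ => ∃ x, N.R d w x ∧ N.Sat x φ

/-! ### Boolean algebras with operators and varieties -/

/-- A boolean algebra with a normal additive unary operator for each element of `M`. -/
class BAO (M : Type u) (A : Type u) [BooleanAlgebra A] where
  dia : M → A → A
  dia_bot : ∀ d : M, dia d ⊥ = ⊥
  dia_sup : ∀ (d : M) (a b : A), dia d (a ⊔ b) = dia d a ⊔ dia d b

/-- Terms of the signature of `M`-BAOs, with variables `v_i` indexed by `ℕ`. -/
inductive Term (M : Type u) : Type u
  | var : ℕ → Term M
  | zero : Term M
  | one : Term M
  | neg : Term M → Term M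
  | add : Term M → Term M → Term M
  | dia : M → Term M → Term M

/-- The value of a term under an assignment to its variables. -/
def Term.eval {M A : Type u} [BooleanAlgebra A] [BAO M A] (h : ℕ → A) : Term M → A
  | .var i => h i
  | .zero => ⊥
  | .one => ⊤
  | .neg t => (t.eval h)ᶜ
  | .add s t => s.eval h ⊔ t.eval h
  | .dia d t => BAO.dia d (t.eval h)

/-- Classes of `M`-BAOs. -/
def BAOClass (M : Type u) : Type (u + 1) :=
  ∀ (A : Type u) [BooleanAlgebra A] [BAO M A], Prop

/-- A variety is a class of `M`-BAOs defined by a set of equations. -/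
def BAOClass.IsVariety {M : Type u} (V : BAOClass M) : Prop :=
  ∃ E : Set (Term M × Term M), ∀ (A : Type u) [BooleanAlgebra A] [BAO M A],
    V A ↔ ∀ e ∈ E, ∀ h : ℕ → A, e.1.eval h = e.2.eval h

/-- `X` generates the `M`-BAO `A`: the only subalgebra containing `X` is `A` itself. -/
def Generates (M : Type u) {A : Type u} [BooleanAlgebra A] [BAO M A] (X : Set A) : Prop :=
  ∀ C : BooleanSubalgebra A, (∀ (d : M), ∀ a ∈ C, BAO.dia d a ∈ C) → X ⊆ C → C = ⊤

/-! ### Canonical frames and canonical extensions -/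

/-- Ultrafilters of a boolean algebra. -/
@[ext]
structure Uf (A : Type u) [BooleanAlgebra A] : Type u where
  carrier : Set A
  inf_mem : ∀ {a b : A}, a ∈ carrier → b ∈ carrier → a ⊓ b ∈ carrier
  mem_of_le : ∀ {a b : A}, a ∈ carrier → a ≤ b → b ∈ carrier
  compl_mem_iff : ∀ {a : A}, aᶜ ∈ carrier ↔ a ∉ carrier

instance {A : Type u} [BooleanAlgebra A] : Membership A (Uf A) := ⟨fun μ a => a ∈ μ.carrier⟩

/-- The canonical frame of an `M`-BAO. -/
def canFrame (M A : Type u) [BooleanAlgebra A] [BAO M A] : Frame M where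
  carrier := Uf A
  R d μ ν := ∀ a : A, a ∈ ν → BAO.dia d a ∈ μ

/-- The canonical extension of an `M`-BAO: the complex algebra of its canonical frame. -/
abbrev CanExt (A : Type u) [BooleanAlgebra A] : Type u := Set (Uf A)

instance (M A : Type u) [BooleanAlgebra A] [BAO M A] : BAO M (CanExt A) where
  dia d X := {μ | ∃ ν ∈ X, (canFrame M A).R d μ ν}
  dia_bot d := by
    ext μ
    simp
  dia_sup d X Y := by
    ext μ
    simp only [Set.sup_eq_union, Set.mem_union, Set.mem_ofPred_eq]
    constructor
    · rintro ⟨ν, h | h, hR⟩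
      · exact Or.inl ⟨ν, h, hR⟩
      · exact Or.inr ⟨ν, h, hR⟩
    · rintro (⟨ν, h, hR⟩ | ⟨ν, h, hR⟩)
      · exact ⟨ν, Or.inl h, hR⟩
      · exact ⟨ν, Or.inr h, hR⟩

/-- (Total) canonicity of a class of `M`-BAOs. -/
def BAOClass.Canonical {M : Type u} (V : BAOClass M) : Prop :=
  ∀ (A : Type u) [BooleanAlgebra A] [BAO M A], V A → V (CanExt A)

/-- `κ`-canonicity: canonicity restricted to the `κ`-generated algebras. -/
def BAOClass.CanonicalIn {M : Type u} (V : BAOClass M) (κ : Cardinal.{u}) : Prop :=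
  ∀ (A : Type u) [BooleanAlgebra A] [BAO M A], V A →
    (∃ X : Set A, #X ≤ κ ∧ Generates M X) → V (CanExt A)

/-- Resolved: totally canonical, or not even `(|M| + ω)`-canonical. -/
def BAOClass.Resolved {M : Type u} (V : BAOClass M) : Prop :=
  V.Canonical ∨ ¬ V.CanonicalIn (#M + ℵ₀)

/-! ### The two-sorted structure `(B, B₊)`

It is presented as a first-order structure on the disjoint union of the two sorts, with a predicate
for the algebra sort. Function symbols take algebra elements to algebra elements; as first-order
function symbols are total, arguments of the wrong sort are read as `0`. -/

/-- The function symbols `+, -, 0, 1` and the diamonds. -/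
inductive Fn (M : Type u) : ℕ → Type u
  | zero : Fn M 0
  | one : Fn M 0
  | neg : Fn M 1
  | dia : M → Fn M 1
  | add : Fn M 2

/-- The relation symbols: the sort predicate, the unary `Q_i` of point sort, membership of an
algebra element in a point, and the accessibility relations between points. -/
inductive Rel (M : Type u) : ℕ → Type u
  | isAlg : Rel M 1
  | Q : ℕ → Rel M 1
  | mem : Rel M 2
  | R : M → Rel M 2

/-- The two-sorted signature `L`. -/
def Lang (M : Type u) : FirstOrder.Language.{u, u} := ⟨Fn M, Rel M⟩

/-- The domain of `(B, B₊)` with `Q_i` interpreted as `g i`. -/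
def Big (M B : Type u) [BooleanAlgebra B] [BAO M B] (_g : ℕ → Set (Uf B)) : Type u := B ⊕ Uf B

section Big

variable {M B : Type u} [BooleanAlgebra B] [BAO M B] {g : ℕ → Set (Uf B)}

/-- The element of algebra sort given by `b`. -/
def Big.alg (b : B) : Big M B g := Sum.inl b

/-- The element of point sort given by `μ`. -/
def Big.pt (μ : Uf B) : Big M B g := Sum.inr μ

/-- The algebra element itself, or `0` for elements of point sort. -/
def Big.toAlg : Big M B g → B := Sum.elim id fun _ => ⊥

instance : (Lang M).Structure (Big M B g) where
  funMap {_} f := match f with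
    | .zero => fun _ => Big.alg ⊥
    | .one => fun _ => Big.alg ⊤
    | .neg => fun x => Big.alg (x 0).toAlgᶜ
    | .dia d => fun x => Big.alg (BAO.dia d (x 0).toAlg)
    | .add => fun x => Big.alg ((x 0).toAlg ⊔ (x 1).toAlg)
  RelMap {_} r := match r with
    | .isAlg => fun x => ∃ b : B, x 0 = Big.alg b
    | .Q i => fun x => ∃ μ ∈ g i, x 0 = Big.pt μ
    | .mem => fun x => ∃ (b : B) (μ : Uf B), x 0 = Big.alg b ∧ x 1 = Big.pt μ ∧ b ∈ μ
    | .R d => fun x => ∃ μ ν : Uf B, x 0 = Big.pt μ ∧ x 1 = Big.pt ν ∧ (canFrame M B).R d μ ν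

/-- The Kripke model `(B₊, g)`. -/
def canModel (M : Type u) {B : Type u} [BooleanAlgebra B] [BAO M B] (g : ℕ → Set (Uf B)) :
    Model M where
  toFrame := canFrame M B
  val := g

end Big

/-! ### Elementary substructures `(A, W)` of `(B, B₊)` -/

section Small

variable {M B : Type u} [BooleanAlgebra B] [BAO M B] {g : ℕ → Set (Uf B)}
variable (S : (Lang M).ElementarySubstructure (Big M B g))

theorem funMap_mem {n : ℕ} (f : (Lang M).Functions n) (x : Fin n → Big M B g)
    (hx : ∀ i, x i ∈ S) :
    FirstOrder.Language.Structure.funMap f x ∈ S :=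
  S.toSubstructure.fun_mem f x hx

/-- The algebra `A`: the elements of algebra sort, a subalgebra of `B`. -/
def algPart : BooleanSubalgebra B :=
  have hc : ∀ {a : B}, (Big.alg a : Big M B g) ∈ S → (Big.alg aᶜ : Big M B g) ∈ S :=
    fun {a} ha => funMap_mem S (Fn.neg : Fn M 1) ![Big.alg a] (by simpa using ha)
  have hs : ∀ {a b : B}, (Big.alg a : Big M B g) ∈ S → (Big.alg b : Big M B g) ∈ S →
      (Big.alg (a ⊔ b) : Big M B g) ∈ S :=
    fun {a b} ha hb => funMap_mem S (Fn.add : Fn M 2) ![Big.alg a, Big.alg b]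
      (by simpa [Fin.forall_fin_two] using ⟨ha, hb⟩)
  { carrier := {b | (Big.alg b : Big M B g) ∈ S}
    supClosed' := fun _ ha _ hb => hs ha hb
    infClosed' := fun a ha b hb => by
      have h := hc (hs (hc ha) (hc hb))
      rwa [compl_sup, compl_compl, compl_compl] at h
    compl_mem' := fun ha => hc ha
    bot_mem' := funMap_mem S (Fn.zero : Fn M 0) ![] (by simp) }

instance : BAO M (algPart S) where
  dia d a := ⟨BAO.dia d (a : B),
    funMap_mem S (Fn.dia d : Fn M 1) ![Big.alg (a : B)] fun _ => by
      rw [Matrix.cons_val_fin_one]; exact a.2⟩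
  dia_bot d := Subtype.ext (BAO.dia_bot d)
  dia_sup d a b := Subtype.ext (BAO.dia_sup d (a : B) (b : B))

/-- The set `W` of elements of point sort. -/
def ptPart : Set (Uf B) := {w | (Big.pt w : Big M B g) ∈ S}

/-- For `w ∈ W`, the ultrafilter `ŵ = {a ∈ A : a ∈ w}` of `A`. -/
def hat (w : ptPart S) : Uf (algPart S) where
  carrier := {a | (a : B) ∈ w.1}
  inf_mem := fun ha hb => w.1.inf_mem ha hb
  mem_of_le := fun ha hab => w.1.mem_of_le ha hab
  compl_mem_iff := w.1.compl_mem_iff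

/-- In `(B, B₊)`, each new constant names the element of `(A, W)` that it comes from. -/
instance : (FirstOrder.Language.constantsOn S).Structure (Big M B g) :=
  FirstOrder.Language.constantsOn.structure fun a : S => (a : Big M B g)

/-- The ultrapower of `(A, W)` by the ultrafilter `U`. -/
def UPow {I : Type u} (U : Ultrafilter I) : Type u := (U : Filter I).Product fun _ => S

/-- The class of a sequence in the ultrapower. -/
def UPow.mk {I : Type u} (U : Ultrafilter I) (s : I → S) : UPow S U :=
  Quotient.mk ((U : Filter I).productSetoid fun _ => S) s

/-- The ultrapower as a structure for the signature with a constant for each element of `(A, W)`,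
where in `(A, W)` each constant names itself. -/
instance {I : Type u} (U : Ultrafilter I) : ((Lang M)[[S]]).Structure (UPow S U) :=
  FirstOrder.Language.Ultraproduct.structure (L := (Lang M)[[S]]) (M := fun _ : I => S) (u := U)

variable {S}

/-- The interpretation in `(A, W)` of the predicate of algebra sort naming the ultrafilter `μ`. -/
def muSmall (μ : Uf (algPart S)) : Set S := {x | ∃ a ∈ μ, (x : Big M B g) = Big.alg (a : B)}

/-- The interpretation of the same predicate in the ultrapower. -/
def muUPow {I : Type u} (U : Ultrafilter I) (μ : Uf (algPart S)) : Set (UPow S U) :=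
  {x | ∃ s : I → S, x = UPow.mk S U s ∧ ∀ᶠ i in (U : Filter I), s i ∈ muSmall μ}

/-- The interpretation of the same predicate in `(B, B₊)`: the preimage of `muUPow` under `σ`. -/
def muBig {I : Type u} {U : Ultrafilter I} (σ : Big M B g ↪ₑ[(Lang M)[[S]]] UPow S U)
    (μ : Uf (algPart S)) : Set B :=
  {b | σ (Big.alg b) ∈ muUPow U μ}

theorem mk_eq_mk {I : Type u} {U : Ultrafilter I} {s t : I → S} :
    UPow.mk S U s = UPow.mk S U t ↔ ∀ᶠ i in (U : Filter I), s i = t i :=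
  Quotient.eq

theorem mk_mem_muUPow {I : Type u} {U : Ultrafilter I} {μ : Uf (algPart S)} {s : I → S} :
    UPow.mk S U s ∈ muUPow U μ ↔ ∀ᶠ i in (U : Filter I), s i ∈ muSmall μ := by
  constructor
  · rintro ⟨t, h, ht⟩
    filter_upwards [mk_eq_mk.1 h, ht] with i h1 h2
    rwa [h1]
  · exact fun h => ⟨s, rfl, h⟩

theorem relMap_mk {I : Type u} {U : Ultrafilter I} {n : ℕ} (r : ((Lang M)[[S]]).Relations n)
    (x : Fin n → I → S) :
    FirstOrder.Language.Structure.RelMap r (fun k => UPow.mk S U (x k)) ↔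
      ∀ᶠ i in (U : Filter I), FirstOrder.Language.Structure.RelMap r fun k => x k i :=
  FirstOrder.Language.relMap_quotient_mk' (s := (U : Filter I).productSetoid fun _ => S) r x

theorem funMap_mk {I : Type u} {U : Ultrafilter I} {n : ℕ} (f : ((Lang M)[[S]]).Functions n)
    (x : Fin n → I → S) :
    FirstOrder.Language.Structure.funMap f (fun k => UPow.mk S U (x k)) =
      UPow.mk S U fun i => FirstOrder.Language.Structure.funMap f fun k => x k i :=
  FirstOrder.Language.Ultraproduct.funMap_cast f x

/-- Each value of `σ` at an algebra element is the class of a sequence of algebra elements. -/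
theorem exists_rep {I : Type u} {U : Ultrafilter I}
    (σ : Big M B g ↪ₑ[(Lang M)[[S]]] UPow S U) (b : B) :
    ∃ s : I → S, σ (Big.alg b) = UPow.mk S U s ∧
      ∀ᶠ i in (U : Filter I), ∃ a : algPart S, (s i : Big M B g) = Big.alg (a : B) := by
  obtain ⟨s, hs⟩ : ∃ s : I → S, UPow.mk S U s = σ (Big.alg b) := Quotient.exists_rep _
  have h : FirstOrder.Language.Structure.RelMap
      (L := (Lang M)[[S]]) (n := 1) (Sum.inl Rel.isAlg) (σ ∘ fun _ => Big.alg b) :=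
    (σ.map_rel _ _).2 ⟨b, rfl⟩
  have h' := (relMap_mk (U := U) (n := 1) (Sum.inl Rel.isAlg : ((Lang M)[[S]]).Relations 1)
    (fun _ => s)).1 (by convert h using 1; funext k; exact hs)
  refine ⟨s, hs.symm, h'.mono ?_⟩
  rintro i ⟨a, ha⟩
  have ha : (s i : Big M B g) = Big.alg a := ha
  exact ⟨⟨a, show Big.alg a ∈ S from ha ▸ (s i).2⟩, ha⟩

theorem map_compl {I : Type u} {U : Ultrafilter I}
    (σ : Big M B g ↪ₑ[(Lang M)[[S]]] UPow S U) {b : B} {s : I → S}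
    (hs : σ (Big.alg b) = UPow.mk S U s) :
    ∃ t : I → S, σ (Big.alg bᶜ) = UPow.mk S U t ∧
      ∀ (i : I) (a : B), (s i : Big M B g) = Big.alg a → (t i : Big M B g) = Big.alg aᶜ := by
  have h := σ.map_fun (n := 1) (Sum.inl Fn.neg : ((Lang M)[[S]]).Functions 1)
    (fun _ => Big.alg b)
  have e : (σ ∘ fun _ : Fin 1 => Big.alg b) = fun k => UPow.mk S U ((fun _ => s) k) := by
    funext k; exact hs
  rw [e] at h
  refine ⟨_, h.trans (funMap_mk _ fun _ => s), fun i a ha => ?_⟩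
  have : (s i : Big M B g).toAlg = a := by rw [ha]; rfl
  rw [← this]
  rfl

theorem map_sup {I : Type u} {U : Ultrafilter I}
    (σ : Big M B g ↪ₑ[(Lang M)[[S]]] UPow S U) {b c : B} {s t : I → S}
    (hs : σ (Big.alg b) = UPow.mk S U s) (ht : σ (Big.alg c) = UPow.mk S U t) :
    ∃ r : I → S, σ (Big.alg (b ⊔ c)) = UPow.mk S U r ∧
      ∀ (i : I) (a a' : B), (s i : Big M B g) = Big.alg a → (t i : Big M B g) = Big.alg a' →
        (r i : Big M B g) = Big.alg (a ⊔ a') := by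
  have h := σ.map_fun (n := 2) (Sum.inl Fn.add : ((Lang M)[[S]]).Functions 2)
    ![Big.alg b, Big.alg c]
  have e : (σ ∘ ![Big.alg b, Big.alg c]) = fun k => UPow.mk S U ((![s, t] : Fin 2 → I → S) k) := by
    funext k
    fin_cases k
    · exact hs
    · exact ht
  rw [e] at h
  refine ⟨_, h.trans (funMap_mk _ ![s, t]), fun i a a' ha ha' => ?_⟩
  have h1 : (s i : Big M B g).toAlg = a := by rw [ha]; rfl
  have h2 : (t i : Big M B g).toAlg = a' := by rw [ha']; rfl
  rw [← h1, ← h2]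
  rfl

theorem mem_muSmall {μ : Uf (algPart S)} {x : S} {a : algPart S}
    (h : (x : Big M B g) = Big.alg (a : B)) : x ∈ muSmall μ ↔ a ∈ μ := by
  constructor
  · rintro ⟨a', ha', h'⟩
    have : a = a' := Subtype.ext (Sum.inl_injective (h.symm.trans h'))
    rwa [this]
  · exact fun ha => ⟨a, ha, h⟩

theorem compl_mem_muBig {I : Type u} {U : Ultrafilter I}
    (σ : Big M B g ↪ₑ[(Lang M)[[S]]] UPow S U) (μ : Uf (algPart S)) {b : B} :
    bᶜ ∈ muBig σ μ ↔ b ∉ muBig σ μ := by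
  obtain ⟨s, hs, hs'⟩ := exists_rep σ b
  obtain ⟨t, ht, ht'⟩ := map_compl σ hs
  change σ _ ∈ muUPow U μ ↔ ¬ (σ _ ∈ muUPow U μ)
  rw [hs, ht, mk_mem_muUPow, mk_mem_muUPow, ← Ultrafilter.eventually_not]
  refine Filter.eventually_congr (hs'.mono ?_)
  rintro i ⟨a, ha⟩
  rw [mem_muSmall ha, mem_muSmall (a := aᶜ) (ht' i a ha)]
  exact μ.compl_mem_iff

theorem sup_mem_muBig {I : Type u} {U : Ultrafilter I}
    (σ : Big M B g ↪ₑ[(Lang M)[[S]]] UPow S U) (μ : Uf (algPart S)) {b c : B} :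
    b ⊔ c ∈ muBig σ μ ↔ b ∈ muBig σ μ ∨ c ∈ muBig σ μ := by
  obtain ⟨s, hs, hs'⟩ := exists_rep σ b
  obtain ⟨t, ht, ht'⟩ := exists_rep σ c
  obtain ⟨r, hr, hr'⟩ := map_sup σ hs ht
  change σ _ ∈ muUPow U μ ↔ σ _ ∈ muUPow U μ ∨ σ _ ∈ muUPow U μ
  rw [hs, ht, hr, mk_mem_muUPow, mk_mem_muUPow, mk_mem_muUPow, ← Ultrafilter.eventually_or]
  refine Filter.eventually_congr ((hs'.and ht').mono ?_)
  rintro i ⟨⟨a, ha⟩, a', ha'⟩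
  rw [mem_muSmall ha, mem_muSmall ha', mem_muSmall (a := a ⊔ a') (hr' i a a' ha ha')]
  constructor
  · intro h
    by_contra! hn
    have h1 := μ.inf_mem (μ.compl_mem_iff.2 hn.1) (μ.compl_mem_iff.2 hn.2)
    rw [← compl_sup] at h1
    exact μ.compl_mem_iff.1 h1 h
  · rintro (h | h)
    · exact μ.mem_of_le h le_sup_left
    · exact μ.mem_of_le h le_sup_right

/-- The map `f : A₊ → B₊` determined by the elementary embedding `σ`. -/
def fMap {I : Type u} {U : Ultrafilter I} (σ : Big M B g ↪ₑ[(Lang M)[[S]]] UPow S U)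
    (μ : Uf (algPart S)) : Uf B where
  carrier := muBig σ μ
  inf_mem := fun {a b} ha hb => by
    by_contra hn
    rw [← compl_mem_muBig, compl_inf, sup_mem_muBig, compl_mem_muBig, compl_mem_muBig] at hn
    exact hn.elim (fun h => h ha) (fun h => h hb)
  mem_of_le := fun {a b} ha hab => by
    rw [← sup_eq_right.2 hab]
    exact (sup_mem_muBig σ μ).2 (Or.inl ha)
  compl_mem_iff := compl_mem_muBig σ μ

/-- The model `𝓜`: the submodel of `(B₊, g)` whose domain is the image under `f` of the inner
subframe of `A₊` generated by `ŵ₀`. -/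
def truthModel {I : Type u} {U : Ultrafilter I} (σ : Big M B g ↪ₑ[(Lang M)[[S]]] UPow S U)
    (w₀ : ptPart S) : Model M :=
  (canModel M g).sub (fMap σ '' (canFrame M (algPart S)).generated (hat S w₀))

end Small

/-- The Truth Lemma holds in `V`: for every `B ∈ V`, every choice `g` of the `Q_i`, every countable
elementary substructure `S = (A, W)` of `(B, B₊)`, every ultrapower of `S` and elementary embedding
`σ` of `(B, B₊)` into it (in the signature with constants for the elements of `S`), every formula
`φ₀` and every `w₀ ∈ W` at which `φ₀` is true in `(B₊, g)`, the model `𝓜` agrees with `(B₊, g)` on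
all formulas at all points of `𝓜`. -/
def BAOClass.TruthLemma {M : Type u} (V : BAOClass M) : Prop :=
  ∀ (B : Type u) [BooleanAlgebra B] [BAO M B], V B →
  ∀ (g : ℕ → Set (Uf B)) (S : (Lang M).ElementarySubstructure (Big M B g)), Countable S →
  ∀ (I : Type u) (U : Ultrafilter I) (σ : Big M B g ↪ₑ[(Lang M)[[S]]] UPow S U)
    (φ₀ : Formula M) (w₀ : ptPart S), (canModel M g).Sat w₀.1 φ₀ →
  ∀ (m : (truthModel σ w₀).carrier) (ψ : Formula M),
    (truthModel σ w₀).Sat m ψ ↔ (canModel M g).Sat m.1 ψ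

end ModalBAO

open ModalBAO

/-! The elementary embedding into an ultrapower comes from Frayne's theorem, applied in the
signature with constants for 𝔄. The constants make σ diagonal on 𝔄, so f(μ) ∩ 𝒜 = μ
(`coe_mem_fMap`); hence f is injective and reflects each relation. The condition R_◇ μν, "◇a ∈ μ for
all a ∈ ν", is first-order in predicates naming μ and ν, so it passes to the ultrapower and pulls
back along σ: f preserves R_◇ (`fMap_isEmbedding`). For w ∈ W, the predicate naming ŵ is definable
from the constant w by the membership relation, so elementarity gives f(ŵ) = w (`fMap_hat`).

For resolvedness, let V be (|M|+ω)-canonical, and suppose that an equation of V fails in the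
canonical extension of some ℬ ∈ V. The failure is the truth of a modal formula at a point w of ℬ₊.
Löwenheim–Skolem puts w in a countable 𝔄. The Truth Lemma carries the formula to the submodel on the
f-image of the subframe generated by ŵ, and f, an isomorphism onto that image, carries it back to ŵ
in 𝒜₊ (`exists_countable_sat`). So the equation fails in the canonical extension of 𝒜, a countable
and hence countably generated member of V: a contradiction. -/

namespace ModalBAO

/-! ### Frayne's theorem -/

section Frayne

variable {L : FirstOrder.Language.{u, u}} {A N : Type u} [L.Structure A] [L.Structure N]

/-- A formula satisfiable in a structure is satisfiable in every elementarily equivalent one. -/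
theorem exists_realize_of_elementarilyEquivalent (h : L.ElementarilyEquivalent A N) [Nonempty A]
    {β : Type u} (φ : L.Formula β) {v : β → N} (hφ : φ.Realize v) :
    ∃ w : β → A, φ.Realize w := by
  classical
  have hN : N ⊨ φ.exClosure := (Language.Formula.realize_exClosure φ).2
    ⟨fun b => v b, (Language.BoundedFormula.realize_restrictFreeVar (f := id) v fun _ => rfl).2 hφ⟩
  obtain ⟨w, hw⟩ := (Language.Formula.realize_exClosure φ).1
    ((Language.elementarilyEquivalent_iff.1 h _).2 hN)
  -- The existential closure supplies values for the free variables only; the other variables get an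
  -- arbitrary value.
  refine ⟨fun b => if hb : b ∈ φ.freeVarFinset then w ⟨b, hb⟩ else Classical.arbitrary A, ?_⟩
  exact (Language.BoundedFormula.realize_restrictFreeVar (f := id) (v := w) _
    fun b => by simp).1 hw

/-- A finite part of the elementary diagram of a structure is satisfiable in every elementarily
equivalent structure. -/
theorem exists_realize_finset (h : L.ElementarilyEquivalent A N) [Nonempty A]
    (F : Finset {φ : L.Formula N // φ.Realize id}) :
    ∃ w : N → A, ∀ φ ∈ F, φ.1.Realize w := by
  obtain ⟨w, hw⟩ := exists_realize_of_elementarilyEquivalent h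
    (Language.Formula.iInf fun φ : F => φ.1.1)
    (v := id) (Language.Formula.realize_iInf.2 fun φ => φ.1.2)
  exact ⟨w, fun φ hφ => Language.Formula.realize_iInf.1 hw ⟨φ, hφ⟩⟩

/-- **Frayne's theorem**: a structure embeds elementarily in an ultrapower of every structure
elementarily equivalent to it. -/
theorem exists_elementaryEmbedding_ultrapower (h : L.ElementarilyEquivalent A N) [Nonempty A] :
    ∃ (I : Type u) (U : Ultrafilter I), Nonempty (N ↪ₑ[L] (U : Filter I).Product fun _ => A) := by
  classical
  choose w hw using exists_realize_finset h
  -- The index set consists of the finite parts of the elementary diagram. An ultrafilter below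
  -- `atTop` contains, for each φ of the diagram, the set of all F with φ ∈ F, so φ survives in the
  -- ultrapower by Łoś's theorem.
  let U : Ultrafilter (Finset {φ : L.Formula N // φ.Realize id}) := Ultrafilter.of Filter.atTop
  let σ : N → (U : Filter (Finset {φ : L.Formula N // φ.Realize id})).Product fun _ => A :=
    fun b => Quotient.mk'' fun F => w F b
  have key : ∀ φ : L.Formula N, φ.Realize id → φ.Realize σ := fun φ hφ => by
    refine (Language.Ultraproduct.realize_formula_cast (u := U) φ fun b F => w F b).2 ?_
    have : ∀ᶠ F in Filter.atTop, φ.Realize (w F) :=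
      (Filter.eventually_ge_atTop {⟨φ, hφ⟩}).mono fun F hF =>
        hw F ⟨φ, hφ⟩ (hF (Finset.mem_singleton_self _))
    exact Ultrafilter.of_le _ this
  refine ⟨_, U, ⟨⟨σ, fun n φ x => ?_⟩⟩⟩
  -- Relabelling by `x` turns φ at `x` into a formula at `id`. Either it or its negation is in the
  -- diagram, so preservation upgrades to an equivalence.
  have h1 := key (φ.relabel x)
  have h2 := key (φ.relabel x).not
  simp only [Language.Formula.realize_not, Language.Formula.realize_relabel,
    Function.id_comp] at h1 h2
  exact ⟨fun hσ => by_contra fun hn => h2 hn hσ, h1⟩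

end Frayne

/-! ### The map f as an embedding of canonical frames -/

section Small

variable {M B : Type u} [BooleanAlgebra B] [BAO M B] {g : ℕ → Set (Uf B)}

theorem elementarilyEquivalent_withConstants (S : (Lang M).ElementarySubstructure (Big M B g)) :
    ((Lang M)[[S]]).ElementarilyEquivalent S (Big M B g) := by
  refine Language.elementarilyEquivalent_iff.2 fun φ => ?_
  rw [← Language.Formula.realize_equivSentence_symm_con S φ,
    ← Language.Formula.realize_equivSentence_symm_con (Big M B g) φ,
    ← S.subtype.map_formula]
  rfl

theorem exists_ultrapower (S : (Lang M).ElementarySubstructure (Big M B g)) :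
    ∃ (I : Type u) (U : Ultrafilter I), Nonempty (Big M B g ↪ₑ[(Lang M)[[S]]] UPow S U) := by
  have : Nonempty (Big M B g) := ⟨Big.alg ⊥⟩
  exact exists_elementaryEmbedding_ultrapower (elementarilyEquivalent_withConstants S)

variable {S : (Lang M).ElementarySubstructure (Big M B g)} {I : Type u} {U : Ultrafilter I}
  (σ : Big M B g ↪ₑ[(Lang M)[[S]]] UPow S U)

/-- The embedding `σ` is the diagonal map on `(A, W)`. -/
theorem map_coe (x : S) : σ (x : Big M B g) = UPow.mk S U fun _ => x := by
  -- The constant for `x` is a nullary symbol, interpreted in the ultrapower by the constant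
  -- sequence.
  have h := σ.map_fun (n := 0) (Sum.inr x : ((Lang M)[[S]]).Functions 0) ![]
  exact h.trans ((congrArg _ (Subsingleton.elim _ _)).trans
    (funMap_mk (U := U) (n := 0) (Sum.inr x : ((Lang M)[[S]]).Functions 0) ![]))

theorem map_dia (d : M) {b : B} {s : I → S} (hs : σ (Big.alg b) = UPow.mk S U s) :
    ∃ t : I → S, σ (Big.alg (BAO.dia d b)) = UPow.mk S U t ∧
      ∀ (i : I) (a : B), (s i : Big M B g) = Big.alg a →
        (t i : Big M B g) = Big.alg (BAO.dia d a) := by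
  have h := σ.map_fun (n := 1) (Sum.inl (Fn.dia d) : ((Lang M)[[S]]).Functions 1)
    (fun _ => Big.alg b)
  have e : (σ ∘ fun _ : Fin 1 => Big.alg b) = fun k => UPow.mk S U ((fun _ => s) k) := by
    funext k; exact hs
  rw [e] at h
  refine ⟨_, h.trans (funMap_mk _ fun _ => s), fun i a ha => ?_⟩
  have : (s i : Big M B g).toAlg = a := by rw [ha]; rfl
  rw [← this]
  rfl

/-- On elements of 𝒜, σ is the diagonal, and a constant sequence lies in μ* exactly when its value
lies in μ. Thus f(μ) extends μ, which yields both injectivity and reflection of the relations. -/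
theorem coe_mem_fMap (μ : Uf (algPart S)) (a : algPart S) : (a : B) ∈ fMap σ μ ↔ a ∈ μ := by
  change σ (Big.alg (a : B)) ∈ muUPow U μ ↔ _
  rw [show σ (Big.alg (a : B)) = _ from map_coe σ ⟨Big.alg a, a.2⟩, mk_mem_muUPow,
    mem_muSmall (a := a) rfl, Filter.eventually_const]

theorem fMap_isEmbedding :
    Frame.IsEmbedding (F := canFrame M (algPart S)) (G := canFrame M B) (fMap σ) := by
  refine ⟨fun μ ν h => Uf.ext (Set.ext fun a => ?_),
    fun d μ ν => ⟨fun h b hb => ?_, fun h a ha => ?_⟩⟩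
  · exact (coe_mem_fMap σ μ a).symm.trans ((by rw [h]) : _ ↔ _) |>.trans (coe_mem_fMap σ ν a)
  · obtain ⟨s, hs, hs'⟩ := exists_rep σ b
    obtain ⟨t, ht, ht'⟩ := map_dia σ d hs
    have hb' : UPow.mk S U s ∈ muUPow U ν := hs ▸ hb
    refine (congrArg (· ∈ muUPow U μ) ht).mpr (mk_mem_muUPow.2 ?_)
    -- At almost every index the coordinate of σ(b) is some a ∈ ν; there `h` puts ◇a, the coordinate
    -- of σ(◇b), in μ.
    filter_upwards [mk_mem_muUPow.1 hb'] with i ⟨a, ha, hsa⟩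
    exact ⟨_, h a ha, ht' i a hsa⟩
  · exact (coe_mem_fMap σ μ (BAO.dia d a)).1 (h _ ((coe_mem_fMap σ ν a).2 ha))

/-- Membership is a relation of the signature and w is named by a constant. So b ∈ w holds exactly
when almost all coordinates of σ(b) belong to w, that is, to ŵ. -/
theorem fMap_hat (w : ptPart S) : fMap σ (hat S w) = w.1 := by
  refine Uf.ext (Set.ext fun b => ?_)
  obtain ⟨s, hs, hs'⟩ := exists_rep σ b
  have h := σ.map_rel (n := 2) (Sum.inl Rel.mem : ((Lang M)[[S]]).Relations 2)
    ![Big.alg b, Big.pt w.1]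
  have e : (σ ∘ ![Big.alg b, Big.pt w.1]) =
      fun k => UPow.mk S U ((![s, fun _ => ⟨Big.pt w.1, w.2⟩] : Fin 2 → I → S) k) := by
    funext k
    fin_cases k
    · exact hs
    · exact map_coe σ ⟨Big.pt w.1, w.2⟩
  rw [e] at h
  have h' :=
    (relMap_mk (U := U) (n := 2) (Sum.inl Rel.mem : ((Lang M)[[S]]).Relations 2) _).symm.trans h
  change σ _ ∈ muUPow U _ ↔ b ∈ w.1
  have hb : b ∈ w.1 ↔ Language.Structure.RelMap (L := (Lang M)[[S]]) (n := 2) (Sum.inl Rel.mem)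
      (![Big.alg b, Big.pt w.1] : Fin 2 → Big M B g) :=
    ⟨fun hb => ⟨b, w.1, rfl, rfl, hb⟩, fun ⟨b', w', h1, h2, h3⟩ => by
      rwa [← Sum.inl_injective h1, ← Sum.inr_injective h2] at h3⟩
  rw [hs, mk_mem_muUPow]
  refine Iff.trans ?_ (h'.trans hb.symm)
  refine Filter.eventually_congr (hs'.mono ?_)
  rintro i ⟨a, ha⟩
  rw [mem_muSmall ha]
  exact ⟨fun h => ⟨a, w.1, ha, rfl, h⟩, fun ⟨b', w', h1, h2, h3⟩ => by
    have h1 : (s i : Big M B g) = Big.alg b' := h1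
    have h2 : (Big.pt w.1 : Big M B g) = Big.pt w' := h2
    rw [← Sum.inl_injective (ha.symm.trans h1), ← Sum.inr_injective h2] at h3
    exact h3⟩

end Small

/-! ### Terms as modal formulas -/

/-- The modal formula with the same boolean and modal structure as a term. -/
def Term.toFormula {M : Type u} : Term M → Formula M
  | .var i => .atom i
  | .zero => .neg .top
  | .one => .top
  | .neg t => .neg t.toFormula
  | .add s t => .or s.toFormula t.toFormula
  | .dia d t => .dia d t.toFormula

/-- The value of a term in a canonical extension is the truth set of the corresponding formula. -/
theorem mem_eval_iff_sat {M A : Type u} [BooleanAlgebra A] [BAO M A] (g : ℕ → Set (Uf A))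
    (t : Term M) (μ : Uf A) :
    μ ∈ (t.eval g : CanExt A) ↔ (canModel M g).Sat μ t.toFormula := by
  induction t generalizing μ with
  | var i => exact Iff.rfl
  | zero => exact ⟨fun h => h.elim, fun h => (h trivial).elim⟩
  | one => exact ⟨fun _ => trivial, fun _ => trivial⟩
  | neg t ih => exact not_congr (ih μ)
  | add s t ihs iht => exact or_congr (ihs μ) (iht μ)
  | dia d t ih =>
    exact ⟨fun ⟨ν, h, hR⟩ => ⟨ν, hR, (ih ν).1 h⟩, fun ⟨ν, hR, h⟩ => ⟨ν, (ih ν).2 h, hR⟩⟩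

/-- The modal formula expressing that two terms differ at a point. -/
def Term.differ {M : Type u} (s t : Term M) : Formula M :=
  .or (.neg (.or s.toFormula (.neg t.toFormula))) (.neg (.or (.neg s.toFormula) t.toFormula))

theorem sat_differ {M : Type u} (N : Model M) (w : N.carrier) (s t : Term M) :
    N.Sat w (s.differ t) ↔ ¬ (N.Sat w s.toFormula ↔ N.Sat w t.toFormula) := by
  simp only [Term.differ, Model.Sat]
  tauto

/-! ### Generated subframes -/

theorem Frame.self_mem_generated {M : Type u} (F : Frame M) (w : F.carrier) :
    w ∈ F.generated w :=
  ⟨[], rfl⟩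

theorem Frame.generated_closed {M : Type u} (F : Frame M) {w x y : F.carrier} {d : M}
    (hx : x ∈ F.generated w) (h : F.R d x y) : y ∈ F.generated w := by
  obtain ⟨s, hs⟩ := hx
  exact ⟨d :: s, x, hs, h⟩

/-- Truth is preserved along an embedding of a generated subframe that pulls back the valuation. -/
theorem sat_iff_sat_sub_image {M : Type u} {F : Frame M} {N : Model M}
    {f : F.carrier → N.carrier} (hf : Frame.IsEmbedding (G := N.toFrame) f) (w : F.carrier)
    (φ : Formula M) (x : F.carrier) (hx : x ∈ F.generated w) :
    Model.Sat ⟨F, fun i => f ⁻¹' N.val i⟩ x φ ↔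
      (N.sub (f '' F.generated w)).Sat ⟨f x, x, hx, rfl⟩ φ := by
  induction φ generalizing x with
  | top => exact Iff.rfl
  | atom i => exact Iff.rfl
  | neg φ ih => exact not_congr (ih x hx)
  | or φ ψ ihφ ihψ => exact or_congr (ihφ x hx) (ihψ x hx)
  | dia d φ ih =>
    constructor
    · rintro ⟨y, hR, hy⟩
      -- Closure under successors keeps every witness for the diamond inside the domain.
      have hy' := F.generated_closed hx hR
      exact ⟨⟨f y, y, hy', rfl⟩, (hf.2 d x y).1 hR, (ih y hy').1 hy⟩
    · rintro ⟨⟨_, y, hy', rfl⟩, hR, hy⟩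
      exact ⟨y, (hf.2 d x y).2 hR, (ih y hy').2 hy⟩

/-! ### Subalgebras and countable elementary substructures -/

section Small

variable {M B : Type u} [BooleanAlgebra B] [BAO M B] {g : ℕ → Set (Uf B)}

theorem coe_eval (S : (Lang M).ElementarySubstructure (Big M B g)) (h : ℕ → algPart S)
    (t : Term M) : ((t.eval h : algPart S) : B) = t.eval fun i => (h i : B) := by
  induction t with
  | var i => rfl
  | zero => rfl
  | one => rfl
  | neg t ih => exact congrArg _ ih
  | add s t ihs iht => exact congrArg₂ _ ihs iht
  | dia d t ih => exact congrArg (BAO.dia d) ih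

/-- A variety contains the algebra part of an elementary substructure of `(B, B₊)` if it
contains `B`. -/
theorem BAOClass.IsVariety.algPart_mem {V : BAOClass M} (hV : V.IsVariety) (hB : V B)
    (S : (Lang M).ElementarySubstructure (Big M B g)) : V (algPart S) := by
  obtain ⟨E, hE⟩ := hV
  refine (hE _).2 fun e he h => Subtype.ext ?_
  rw [coe_eval, coe_eval]
  exact (hE B).1 hB e he _

theorem countable_algPart (S : (Lang M).ElementarySubstructure (Big M B g)) [Countable S] :
    Countable (algPart S) :=
  Function.Injective.countable (f := fun a : algPart S => (⟨Big.alg (a : B), a.2⟩ : S))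
    fun _ _ h => Subtype.ext (Sum.inl_injective (congrArg Subtype.val h))

theorem card_lang_le [Countable M] : (Lang M).card ≤ ℵ₀ := by
  have : ∀ n, Countable (Fn M n) := fun n => by
    refine Function.Injective.countable
      (f := fun x : Fn M n => (match x with
        | .zero => Sum.inl 0
        | .one => Sum.inl 1
        | .neg => Sum.inl 2
        | .add => Sum.inl 3
        | .dia d => Sum.inr d : ℕ ⊕ M)) ?_
    rintro x y h
    cases x <;> cases y <;> simp_all
  have : ∀ n, Countable (Rel M n) := fun n => by
    refine Function.Injective.countable
      (f := fun x : Rel M n => (match x with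
        | .isAlg => Sum.inl 0
        | .mem => Sum.inl 1
        -- The shift by 2 avoids the codes of `isAlg` and `mem`.
        | .Q i => Sum.inl (i + 2)
        | .R d => Sum.inr d : ℕ ⊕ M)) ?_
    rintro x y h
    cases x <;> cases y <;> simp_all
  have : ∀ n, Countable ((Lang M).Functions n) := fun n => inferInstanceAs (Countable (Fn M n))
  have : ∀ n, Countable ((Lang M).Relations n) := fun n => inferInstanceAs (Countable (Rel M n))
  exact Cardinal.mk_le_aleph0_iff.2 (inferInstanceAs (Countable (_ ⊕ _)))

/-- Every element of `(B, B₊)` lies in a countable elementary substructure. -/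
theorem exists_countable_elementarySubstructure [Countable M] (x : Big M B g) :
    ∃ S : (Lang M).ElementarySubstructure (Big M B g), Countable S ∧ x ∈ S := by
  -- Downward Löwenheim–Skolem, at cardinality exactly ℵ₀, needs an infinite structure; a countable
  -- structure serves as its own substructure.
  rcases le_total ℵ₀ #(Big M B g) with h | h
  · obtain ⟨S, hxS, hS⟩ :=
      Language.exists_elementarySubstructure_card_eq (Lang M) {x} (ℵ₀ : Cardinal.{u})
      le_rfl (by simp) (by simpa using card_lang_le) (by simpa using h)
    refine ⟨S, Cardinal.mk_le_aleph0_iff.1 ?_, hxS rfl⟩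
    simpa using hS.le
  · have : Countable (Big M B g) := Cardinal.mk_le_aleph0_iff.1 h
    exact ⟨⊤, inferInstanceAs (Countable (Subtype _)), Language.ElementarySubstructure.mem_top x⟩

end Small

/-! ### Descent to countable algebras and resolvedness -/

/-- If the Truth Lemma holds in a variety, every formula satisfiable on the canonical frame of a
member is satisfiable on the canonical frame of a countable member. -/
theorem exists_countable_sat {M : Type u} [Countable M] {V : BAOClass M} (hV : V.IsVariety)
    (hT : V.TruthLemma) {B : Type u} [BooleanAlgebra B] [BAO M B] (hB : V B)
    (g : ℕ → Set (Uf B)) (w : Uf B) (φ : Formula M) (hw : (canModel M g).Sat w φ) :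
    ∃ S : (Lang M).ElementarySubstructure (Big M B g), Countable (algPart S) ∧ V (algPart S) ∧
      ∃ (g' : ℕ → Set (Uf (algPart S))) (μ : Uf (algPart S)), (canModel M g').Sat μ φ := by
  obtain ⟨S, hS, hwS⟩ := exists_countable_elementarySubstructure (Big.pt w : Big M B g)
  refine ⟨S, countable_algPart S, hV.algPart_mem hB S, ?_⟩
  obtain ⟨I, U, ⟨σ⟩⟩ := exists_ultrapower S
  let w₀ : ptPart S := ⟨w, hwS⟩
  have hmem := (canFrame M (algPart S)).self_mem_generated (hat S w₀)
  -- Pulling `g` back along f makes f an isomorphism of models from the part generated by ŵ onto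
  -- `truthModel`.
  refine ⟨fun i => fMap σ ⁻¹' g i, hat S w₀, ?_⟩
  refine (sat_iff_sat_sub_image (N := canModel M g) (fMap_isEmbedding σ) (hat S w₀) φ _ hmem).2 ?_
  -- The Truth Lemma is needed only for φ itself and only at the point f(ŵ) = w.
  refine (hT B hB g S hS I U σ φ w₀ hw ⟨_, _, hmem, rfl⟩ φ).2 ?_
  change (canModel M g).Sat (fMap σ (hat S w₀)) φ
  rwa [fMap_hat]

theorem BAOClass.IsVariety.resolved_of_truthLemma {M : Type u} [Countable M] {V : BAOClass M}
    (hV : V.IsVariety) (hT : V.TruthLemma) : V.Resolved := by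
  refine or_iff_not_imp_right.2 fun hc => ?_
  rw [not_not] at hc
  intro B _ _ hB
  obtain ⟨E, hE⟩ := id hV
  refine (hE (CanExt B)).2 fun e he g => Set.ext fun w => ?_
  by_contra hw
  -- An assignment into the canonical extension is a valuation on the canonical frame, so a failing
  -- equation is a formula satisfied at `w`.
  rw [mem_eval_iff_sat, mem_eval_iff_sat] at hw
  obtain ⟨S, hS, hVS, g', μ, hμ⟩ := exists_countable_sat hV hT hB g w _ ((sat_differ _ _ _ _).2 hw)
  refine (sat_differ _ _ _ _).1 hμ ?_
  rw [← mem_eval_iff_sat, ← mem_eval_iff_sat]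
  have hgen : V (CanExt (algPart S)) := hc (algPart S) hVS
    -- A countable algebra is generated by all of its elements, at most ℵ₀ many.
    ⟨Set.univ, (Cardinal.mk_le_aleph0_iff.2 (inferInstanceAs (Countable (Set.univ : Set _)))).trans
      (self_le_add_left _ _), fun C _ hC => top_le_iff.1 fun a _ => hC (Set.mem_univ a)⟩
  rw [(hE (CanExt (algPart S))).1 hgen e he g']

end ModalBAO

open ModalBAO
theorem mainTheorem2 {M : Type u} [Countable M] (V : BAOClass M) (hV : V.IsVariety) :
    (∀ (B : Type u) [BooleanAlgebra B] [BAO M B], V B →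
      ∀ (g : ℕ → Set (Uf B)) (S : (Lang M).ElementarySubstructure (Big M B g)), Countable S →
        (∃ (I : Type u) (U : Ultrafilter I), Nonempty (Big M B g ↪ₑ[(Lang M)[[S]]] UPow S U)) ∧
        ∀ (I : Type u) (U : Ultrafilter I) (σ : Big M B g ↪ₑ[(Lang M)[[S]]] UPow S U),
          Frame.IsEmbedding (F := canFrame M (algPart S)) (G := canFrame M B) (fMap σ) ∧
          ∀ w : ptPart S, fMap σ (hat S w) = w.1) ∧
    (V.TruthLemma → V.Resolved) :=
  ⟨fun _ _ _ _ _ S _ => ⟨exists_ultrapower S, fun _ _ σ => ⟨fMap_isEmbedding σ, fMap_hat σ⟩⟩,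
    hV.resolved_of_truthLemma⟩
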